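/- Let $U\subseteq\mathbb{C}$ be open, let $f:U\to\mathbb{C}$ be analytic, let $n\ge 1$, and let $N\in M_n(\mathbb{C})$ be nilpotent. For $X\in M_n(\mathbb{C})$ with all eigenvalues in $U$, the matrix $f(X)$ is defined by the analytic functional calculus: on the characteristic subspace of $X$ for an eigenvalue $\mu$ it acts as $\sum_{k\ge 0}\frac{f^{(k)}(\mu)}{k!}(X-\mu I_n)^k$. The Jordan profile of $N$ is the finitely supported sequence $(m_k)_{k\ge 1}$ of non-negative integers in which $m_k$ is the number of Jordan cells of size $k$ in the Jordan normal form of $N$. For $k\ge 1$ let $e_k$ be the sequence with entry $1$ at position $k$ and $0$ elsewhere, and let $e_0$ be the zero sequence. A zero $x\in U$ of $f$ has infinite multiplicity if $f$ vanishes on a neighborhood of $x$; otherwise its multiplicity is the (finite) order of vanishing of $f$ at $x$. The following conditions are equivalent: (i) There exists $X\in M_n(\mathbb{C})$, with all eigenvalues in $U$, such that $f(X)=N$. (ii) The Jordan profile of $N$ belongs to the additive sub-semigroup of $\mathbb{N}^{(\mathbb{N}^*)}$ (the finitely supported sequences of non-negative integers indexed by the positive integers) generated by all the elements $(p-r)\,e_a+r\,e_{a+1}$,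 where $p$ is the finite multiplicity of some zero of $f$ in $U$, $a\ge 0$ is an integer and $0\le r\le p$ is an integer, together with the additional element $e_1$ if $f$ has a zero of infinite multiplicity in $U$. -/

import Mathlib

/-- The Jordan cell `J_k`: ones at the spots `(i, i + 1)`, zeros elsewhere. -/
def jordanCell (k : ℕ) : Matrix (Fin k) (Fin k) ℂ :=
  Matrix.of fun i j => if (i : ℕ) + 1 = (j : ℕ) then 1 else 0

/-- `N` is similar to the direct sum of the Jordan cells of sizes `d 0, …, d (s - 1)`. -/
def IsSimilarToJordanSum {n s : ℕ} (N : Matrix (Fin n) (Fin n) ℂ) (d : Fin s → ℕ+) : Prop :=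
  ∃ (e : (Σ i : Fin s, Fin (d i : ℕ)) ≃ Fin n) (P : GL (Fin n) ℂ),
    N = (P : Matrix (Fin n) (Fin n) ℂ) *
      Matrix.reindex e e (Matrix.blockDiagonal' fun i => jordanCell (d i : ℕ)) *
      ((P⁻¹ : GL (Fin n) ℂ) : Matrix (Fin n) (Fin n) ℂ)

/-- `m : ℕ+ →₀ ℕ` is the Jordan profile of `N`: in a Jordan normal form of `N` (all of whose
eigenvalues are zero), there are exactly `m k` cells of size `k`, for every `k ≥ 1`. -/
def IsJordanProfile {n : ℕ} (N : Matrix (Fin n) (Fin n) ℂ) (m : ℕ+ →₀ ℕ) : Prop :=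
  ∃ (s : ℕ) (d : Fin s → ℕ+), IsSimilarToJordanSum N d ∧
    ∀ k : ℕ+, m k = (Finset.univ.filter fun i : Fin s => d i = k).card

/-- The profile `e_k` of `J_k`, with the convention `e_0 = 0`. -/
noncomputable def cellProfile (k : ℕ) : ℕ+ →₀ ℕ :=
  if h : 0 < k then Finsupp.single ⟨k, h⟩ 1 else 0

/-- The profiles `(p - r) e_a + r e_{a + 1}`, where `p` is the finite multiplicity of a zero of `f`
in `U`, `a ≥ 0` and `0 ≤ r ≤ p`, together with `e_1` if `f` has a zero of infinite
multiplicity in `U`. -/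
def profileGenerators (U : Set ℂ) (f : ℂ → ℂ) : Set (ℕ+ →₀ ℕ) :=
  {m | ∃ x ∈ U, f x = 0 ∧ ∃ p : ℕ, analyticOrderAt f x = (p : ℕ∞) ∧
      ∃ a r : ℕ, r ≤ p ∧ m = (p - r) • cellProfile a + r • cellProfile (a + 1)} ∪
  {m | (∃ x ∈ U, f x = 0 ∧ analyticOrderAt f x = ⊤) ∧ m = cellProfile 1}

theorem isCompl_maxGenEigenspace {n : ℕ} (T : Module.End ℂ (Fin n → ℂ)) (μ : ℂ) :
    IsCompl (T.maxGenEigenspace μ) (⨆ (ν : ℂ) (_ : ν ≠ μ), T.maxGenEigenspace ν) := by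
  refine ⟨T.independent_maxGenEigenspace μ, codisjoint_iff.mpr (top_le_iff.mp ?_)⟩
  rw [← Module.End.iSup_maxGenEigenspace_eq_top T]
  refine iSup_le fun ν => ?_
  by_cases h : ν = μ
  · exact h ▸ le_sup_left
  · exact le_sup_of_le_right (le_iSup₂_of_le ν h le_rfl)

/-- The projection of `ℂⁿ` onto the characteristic subspace of `X` for `μ`, along the sum of the
other characteristic subspaces (it is zero if `μ` is not an eigenvalue). -/
noncomputable def spectralProjection {n : ℕ} (X : Matrix (Fin n) (Fin n) ℂ) (μ : ℂ) :
    Matrix (Fin n) (Fin n) ℂ :=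
  LinearMap.toMatrix' (Submodule.projection _ _ (isCompl_maxGenEigenspace (Matrix.toLin' X) μ))

/-- The matrix `f(X)` for `f` analytic near the eigenvalues of `X`: on the characteristic subspace
for `μ`, where `X - μ` is nilpotent of index at most `n`, it is the Taylor expansion
`∑ₖ f⁽ᵏ⁾(μ) / k! (X - μ)ᵏ`. -/
noncomputable def matrixFunction {n : ℕ} (f : ℂ → ℂ) (X : Matrix (Fin n) (Fin n) ℂ) :
    Matrix (Fin n) (Fin n) ℂ :=
  ∑ μ ∈ X.charpoly.roots.toFinset,
    (∑ k ∈ Finset.range n,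
      (iteratedDeriv k f μ / (k.factorial : ℂ)) • (X - Matrix.scalar (Fin n) μ) ^ k) *
      spectralProjection X μ

/-! The structure theorem for torsion `ℂ[X]`-modules splits any `X` into Jordan cells
(`exists_isJordanDecomposition`), and `f(X)` acts on each cell as the Taylor expansion of `f` in the
nilpotent shift `T`. So the profile of `f(X)` is the sum of the profiles of single cells.

At a zero `μ` of finite order `p`, the expansion on a cell of size `a p + r` is `T ^ p` times a unit
commuting with `T`. The vectors `v, T v, …, T ^ (p - 1) v`, with `v` cyclic, then generate `p - r`
chains of length `a` and `r` of length `a + 1` (`hasJordanProfile_pow_mul`). At a zero of infinite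
order the expansion is `0`, and a cell of size `k` gives `k e_1`.

If `f(X)` is nilpotent, `f` vanishes at every eigenvalue of `X`, so only these two cases occur.
Conversely, one cell per generator yields a direct sum whose image under `f` has the profile of `N`;
equal profiles mean similarity (`HasJordanProfile.exists_equiv`), and conjugating gives `X`. -/

/-! ### Jordan bases and profiles -/

/-- `b` is a Jordan basis of the nilpotent endomorphism `S`, with chains of lengths `d i`. -/
structure IsJordanBasis {V ι : Type*} [AddCommGroup V] [Module ℂ V] (S : Module.End ℂ V)
    (d : ι → ℕ) (b : Module.Basis (Σ i, Fin (d i)) ℂ V) : Prop where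
  zero : ∀ i (j : Fin (d i)), (j : ℕ) = 0 → S (b ⟨i, j⟩) = 0
  succ : ∀ i (j j' : Fin (d i)), (j : ℕ) + 1 = j' → S (b ⟨i, j'⟩) = b ⟨i, j⟩

/-- `S` has a Jordan basis whose chain lengths have profile `m`; chains of length zero are
allowed. -/
def HasJordanProfile {V : Type*} [AddCommGroup V] [Module ℂ V] (S : Module.End ℂ V)
    (m : ℕ+ →₀ ℕ) : Prop :=
  ∃ (ι : Type) (_ : Fintype ι) (d : ι → ℕ) (b : Module.Basis (Σ i, Fin (d i)) ℂ V),
    IsJordanBasis S d b ∧ m = ∑ i, cellProfile (d i)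

theorem cellProfile_zero : cellProfile 0 = 0 := by simp [cellProfile]

theorem cellProfile_pnat (k : ℕ+) : cellProfile k = Finsupp.single k 1 := by
  simp only [cellProfile, k.pos, dif_pos]
  rfl

theorem sum_cellProfile_apply {ι : Type*} [Fintype ι] (d : ι → ℕ+) (k : ℕ+) :
    (∑ i, cellProfile (d i)) k = (Finset.univ.filter fun i => d i = k).card := by
  simp [cellProfile_pnat, Finsupp.finsetSum_apply, Finsupp.single_apply]

/-- The chains of length zero can be dropped. -/
theorem HasJordanProfile.exists_pnat {V : Type*} [AddCommGroup V] [Module ℂ V]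
    {S : Module.End ℂ V} {m : ℕ+ →₀ ℕ} (h : HasJordanProfile S m) :
    ∃ (s : ℕ) (d : Fin s → ℕ+) (b : Module.Basis (Σ i, Fin (d i : ℕ)) ℂ V),
      IsJordanBasis S (fun i => (d i : ℕ)) b ∧ m = ∑ i, cellProfile (d i) := by
  classical
  obtain ⟨ι, _, d, b, hb, rfl⟩ := h
  let e := (Fintype.equivFin {i // 0 < d i}).symm
  let d' : Fin (Fintype.card {i // 0 < d i}) → ℕ+ := fun t => ⟨d (e t), (e t).2⟩
  let g : (Σ t, Fin (d' t : ℕ)) → Σ i, Fin (d i) := fun x => ⟨(e x.1).1, x.2⟩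
  have hg : Function.Bijective g := by
    constructor
    · rintro ⟨t, j⟩ ⟨t', j'⟩ h
      obtain ⟨h1, h2⟩ := Sigma.mk.inj_iff.mp h
      obtain rfl := e.injective (Subtype.ext h1)
      exact congrArg _ (eq_of_heq h2)
    · rintro ⟨i, j⟩
      have hi : 0 < d i := j.pos
      obtain ⟨t, ht⟩ := e.surjective ⟨i, hi⟩
      obtain rfl : (e t).1 = i := by rw [ht]
      exact ⟨⟨t, j⟩, rfl⟩
  refine ⟨_, d', b.reindex (Equiv.ofBijective g hg).symm, ⟨?_, ?_⟩, ?_⟩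
  · intro i j hj
    rw [Module.Basis.reindex_apply]
    exact hb.zero _ _ hj
  · intro i j j' hj
    rw [Module.Basis.reindex_apply, Module.Basis.reindex_apply]
    exact hb.succ _ _ _ hj
  · change _ = ∑ t, cellProfile (d (e t))
    rw [e.sum_comp (fun i : {i // 0 < d i} => cellProfile (d i)),
      ← Finset.sum_subtype (p := fun i => 0 < d i)
        (Finset.univ.filter fun i => 0 < d i) (by simp) (fun i => cellProfile (d i)), Finset.sum_filter]
    refine Finset.sum_congr rfl fun i _ => ?_
    split_ifs with hi
    · rfl
    · rw [Nat.eq_zero_of_not_pos hi, cellProfile_zero]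

/-- Two endomorphisms with the same Jordan profile are similar. -/
theorem HasJordanProfile.exists_equiv {V W : Type*} [AddCommGroup V] [Module ℂ V]
    [AddCommGroup W] [Module ℂ W] {S : Module.End ℂ V} {S' : Module.End ℂ W} {m : ℕ+ →₀ ℕ}
    (h : HasJordanProfile S m) (h' : HasJordanProfile S' m) :
    ∃ φ : V ≃ₗ[ℂ] W, ∀ v, φ (S v) = S' (φ v) := by
  classical
  obtain ⟨s, d, b, hb, rfl⟩ := h.exists_pnat
  obtain ⟨s', d', b', hb', hm⟩ := h'.exists_pnat
  have hcard (k : ℕ+) : Nonempty ({i // d i = k} ≃ {i // d' i = k}) := by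
    refine Fintype.card_eq.mp ?_
    rw [Fintype.card_subtype, Fintype.card_subtype, ← sum_cellProfile_apply,
      ← sum_cellProfile_apply, hm]
  -- Equal numbers of chains of each length glue to a length-preserving bijection of chains.
  obtain ⟨σ, rfl⟩ : ∃ σ : Fin s ≃ Fin s', d = d' ∘ σ :=
    ⟨Equiv.ofFiberEquiv fun k => (hcard k).some, funext fun i =>
      (Equiv.ofFiberEquiv_map (fun k => (hcard k).some) i).symm⟩
  let τ : (Σ i, Fin ((d' ∘ σ) i : ℕ)) ≃ Σ i, Fin (d' i : ℕ) :=
    Equiv.sigmaCongrLeft (β := fun i => Fin (d' i : ℕ)) σ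
  have hτ (i j) : τ ⟨i, j⟩ = ⟨σ i, j⟩ := rfl
  refine ⟨b.equiv b' τ, fun v => ?_⟩
  have : (b.equiv b' τ).toLinearMap ∘ₗ S = S' ∘ₗ (b.equiv b' τ).toLinearMap := by
    refine b.ext ?_
    rintro ⟨i, j⟩
    rcases Nat.eq_zero_or_eq_succ_pred (j : ℕ) with hj | hj
    · simp [hb.zero i j hj, hτ, hb'.zero (σ i) j hj]
    · have hlt : (j : ℕ) - 1 < ((d' ∘ σ) i : ℕ) := by have := j.2; lia
      have h1 : ((⟨(j : ℕ) - 1, hlt⟩ : Fin ((d' ∘ σ) i : ℕ)) : ℕ) + 1 = j := by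
        simp only; lia
      simp [hb.succ i _ j h1, hτ, hb'.succ (σ i) _ j h1]
  exact LinearMap.congr_fun this v

theorem HasJordanProfile.pi {ι : Type} [Fintype ι] {V : ι → Type*}
    [∀ i, AddCommGroup (V i)] [∀ i, Module ℂ (V i)] {S : ∀ i, Module.End ℂ (V i)}
    {m : ι → ℕ+ →₀ ℕ} (h : ∀ i, HasJordanProfile (S i) (m i)) :
    HasJordanProfile (LinearMap.pi fun i => S i ∘ₗ LinearMap.proj i) (∑ i, m i) := by
  classical
  choose κ hκ d b hb hm using h
  have key (i : ι) (v : V i) : (LinearMap.pi fun i => S i ∘ₗ LinearMap.proj i) (Pi.single i v) =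
      Pi.single i (S i v) := by
    ext j
    by_cases hj : j = i
    · subst hj; simp
    · simp [hj]
  refine ⟨Σ i, κ i, inferInstance, fun x => d x.1 x.2,
    (Pi.basis b).reindex (Equiv.sigmaAssoc fun i (j : κ i) => Fin (d i j)).symm, ⟨?_, ?_⟩, ?_⟩
  · rintro ⟨i, c⟩ j hj
    rw [Module.Basis.reindex_apply, Pi.basis_apply, key]
    exact (congrArg _ ((hb i).zero c j hj)).trans (Pi.single_zero i)
  · rintro ⟨i, c⟩ j j' hj
    rw [Module.Basis.reindex_apply, Module.Basis.reindex_apply, Pi.basis_apply, Pi.basis_apply, key]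
    exact congrArg _ ((hb i).succ c j j' hj)
  · rw [Fintype.sum_sigma]
    exact Finset.sum_congr rfl fun i _ => hm i

theorem HasJordanProfile.conj {V W : Type*} [AddCommGroup V] [Module ℂ V]
    [AddCommGroup W] [Module ℂ W] {S : Module.End ℂ V} {S' : Module.End ℂ W} {m : ℕ+ →₀ ℕ}
    (h : HasJordanProfile S m) (φ : V ≃ₗ[ℂ] W) (hφ : ∀ v, φ (S v) = S' (φ v)) :
    HasJordanProfile S' m := by
  obtain ⟨ι, _, d, b, hb, rfl⟩ := h
  refine ⟨ι, _, d, b.map φ, ⟨fun i j hj => ?_, fun i j j' hj => ?_⟩, rfl⟩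
  · rw [Module.Basis.map_apply, ← hφ, hb.zero i j hj, map_zero]
  · rw [Module.Basis.map_apply, ← hφ, hb.succ i j j' hj, Module.Basis.map_apply]

theorem isJordanBasis_iff_toMatrix {V ι : Type*} [AddCommGroup V] [Module ℂ V] [Fintype ι]
    [DecidableEq ι] {S : Module.End ℂ V} {d : ι → ℕ} {b : Module.Basis (Σ i, Fin (d i)) ℂ V} :
    IsJordanBasis S d b ↔
      LinearMap.toMatrix b b S = Matrix.blockDiagonal' fun i => jordanCell (d i) := by
  have hz (i) (j : Fin (d i)) (hj : (j : ℕ) = 0) (x) :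
      Matrix.blockDiagonal' (fun i => jordanCell (d i)) x ⟨i, j⟩ = 0 := by
    obtain ⟨i', j'⟩ := x
    by_cases h : i' = i
    · subst h
      simp [Matrix.blockDiagonal'_apply, jordanCell, hj]
    · simp [Matrix.blockDiagonal'_apply, h]
  have hs (i) (j j' : Fin (d i)) (hj : (j : ℕ) + 1 = j') (x) :
      Matrix.blockDiagonal' (fun i => jordanCell (d i)) x ⟨i, j'⟩ = b.repr (b ⟨i, j⟩) x := by
    obtain ⟨i', j''⟩ := x
    by_cases h : i' = i
    · subst h
      simp [Matrix.blockDiagonal'_apply, jordanCell, Finsupp.single_apply, ← hj, Fin.ext_iff,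
        eq_comm]
    · rw [Module.Basis.repr_self, Finsupp.single_apply, if_neg (by rintro ⟨⟩; exact h rfl)]
      simp [Matrix.blockDiagonal'_apply, h]
  constructor
  · intro h
    ext x ⟨i, j⟩
    rw [LinearMap.toMatrix_apply]
    rcases Nat.eq_zero_or_eq_succ_pred (j : ℕ) with hj | hj
    · simp [h.zero i j hj, hz i j hj]
    · have hlt : (j : ℕ) - 1 < d i := by have := j.2; lia
      have h1 : ((⟨(j : ℕ) - 1, hlt⟩ : Fin (d i)) : ℕ) + 1 = j := by
        simp only; lia
      rw [h.succ i _ j h1, hs i _ j h1]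
  · intro h
    refine ⟨fun i j hj => b.repr.injective ?_, fun i j j' hj => b.repr.injective ?_⟩
    · ext x
      rw [← LinearMap.toMatrix_apply, h, hz i j hj]
      simp
    · ext x
      rw [← LinearMap.toMatrix_apply, h, hs i j j' hj]

/-- A matrix has Jordan profile `m` if and only if the corresponding endomorphism does. -/
theorem isJordanProfile_iff {n : ℕ} (N : Matrix (Fin n) (Fin n) ℂ) (m : ℕ+ →₀ ℕ) :
    IsJordanProfile N m ↔ HasJordanProfile (Matrix.toLin' N) m := by
  constructor
  · rintro ⟨s, d, ⟨e, P, hN⟩, hm⟩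
    let b₀ : Module.Basis (Σ i : Fin s, Fin (d i : ℕ)) ℂ (Fin n → ℂ) :=
      (Pi.basisFun ℂ (Fin n)).reindex e.symm
    let B := Matrix.reindex e e (Matrix.blockDiagonal' fun i => jordanCell (d i : ℕ))
    have h0 : HasJordanProfile (Matrix.toLin' B) m := by
      refine ⟨Fin s, inferInstance, fun i => d i, b₀, isJordanBasis_iff_toMatrix.mpr ?_, ?_⟩
      · ext x y
        have hy : b₀ y = Pi.single (e y) 1 := by simp [b₀]
        have hx (v : Fin n → ℂ) : b₀.repr v x = v (e x) := by simp [b₀]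
        rw [LinearMap.toMatrix_apply, hx, hy, Matrix.toLin'_apply, Matrix.mulVec_single_one]
        simp [B]
      · ext k
        rw [hm, sum_cellProfile_apply]
    refine h0.conj (Matrix.toLin'OfInv (M := P⁻¹.1) (M' := P.1) (by simp) (by simp)) fun v => ?_
    have : N * P.1 = P.1 * B := by
      rw [hN, mul_assoc]; simp [B]
    change P.1.mulVec (B.mulVec v) = N.mulVec (P.1.mulVec v)
    rw [Matrix.mulVec_mulVec, Matrix.mulVec_mulVec, this]
  · intro h
    obtain ⟨s, d, b, hb, rfl⟩ := h.exists_pnat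
    have hcard : Fintype.card (Σ i : Fin s, Fin (d i : ℕ)) = Fintype.card (Fin n) := by
      rw [← Module.finrank_eq_card_basis b]; simp
    let e := Fintype.equivOfCardEq hcard
    refine ⟨s, d, ⟨e, ?_⟩, sum_cellProfile_apply d⟩
    let c := Pi.basisFun ℂ (Fin n)
    let b' := b.reindex e
    have h1 : c.toMatrix b' * b'.toMatrix c = 1 := Module.Basis.toMatrix_mul_toMatrix_flip _ _
    have h2 : b'.toMatrix c * c.toMatrix b' = 1 := Module.Basis.toMatrix_mul_toMatrix_flip _ _
    refine ⟨⟨c.toMatrix b', b'.toMatrix c, h1, h2⟩, ?_⟩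
    have h3 : Matrix.reindex e e (Matrix.blockDiagonal' fun i => jordanCell (d i : ℕ)) =
        LinearMap.toMatrix b' b' (Matrix.toLin' N) := by
      rw [← isJordanBasis_iff_toMatrix.mp hb]
      ext x y
      simp [LinearMap.toMatrix_apply, b']
    rw [h3]
    change N = c.toMatrix b' * _ * b'.toMatrix c
    rw [basis_toMatrix_mul_linearMap_toMatrix_mul_basis_toMatrix]
    ext x y
    simp [c]

/-! ### Powers of a cyclic nilpotent endomorphism -/

theorem sum_ite_fin_lt {M : Type*} [AddCommMonoid M] {p r : ℕ} (hr : r ≤ p) (x y : M) :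
    ∑ c : Fin p, (if (c : ℕ) < r then x else y) = (p - r) • y + r • x := by
  rw [Fin.sum_univ_eq_sum_range (fun c => if c < r then x else y), Finset.sum_ite,
    Finset.sum_const, Finset.sum_const, add_comm]
  have h1 : (Finset.range p).filter (fun c => c < r) = Finset.range r := by
    ext c; simp; lia
  have h2 : (Finset.range p).filter (fun c => ¬ c < r) = Finset.Ico r p := by
    ext c; simp; lia
  rw [h1, h2]
  simp

/-- If `T` is a cyclic nilpotent endomorphism of index `a p + r`, then `T ^ p` times a unit
commuting with `T` has `p - r` chains of length `a` and `r` chains of length `a + 1`. -/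
theorem hasJordanProfile_pow_mul {V : Type*} [AddCommGroup V] [Module ℂ V]
    [FiniteDimensional ℂ V] {T u : Module.End ℂ V} {v : V} {p a r : ℕ} (hr : r ≤ p)
    (hT : T ^ (a * p + r) = 0) (hspan : ⊤ ≤ Submodule.span ℂ (Set.range fun i : ℕ => (T ^ i) v))
    (hdim : Module.finrank ℂ V = a * p + r) (hu : IsUnit u) (hTu : Commute T u) :
    HasJordanProfile (T ^ p * u) ((p - r) • cellProfile a + r • cellProfile (a + 1)) := by
  classical
  set S := T ^ p * u with hS
  have hTS (j : ℕ) : S ^ j = u ^ j * T ^ (p * j) := by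
    rw [hS, (hTu.pow_left p).mul_pow, ← pow_mul]
    exact ((hTu.pow_left _).pow_right _).eq
  have hT0 (i : ℕ) (hi : a * p + r ≤ i) : T ^ i = 0 := pow_eq_zero_of_le hi hT
  let d : Fin p → ℕ := fun c => if (c : ℕ) < r then a + 1 else a
  -- `S ^ d c` sends `T ^ c v` to a unit times `T ^ (p * d c + c) v`, so this bound makes the `c`-th
  -- chain stop after `d c` steps.
  have hd (c : Fin p) : a * p + r ≤ p * d c + c := by
    simp only [d]
    split_ifs <;> nlinarith [c.2]
  -- The index is reversed: the generator `T ^ c v` sits at `j = d c - 1` and the kernel vector at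
  -- `j = 0`.
  let w : (Σ c, Fin (d c)) → V := fun x => (S ^ (d x.1 - 1 - x.2)) ((T ^ (x.1 : ℕ)) v)
  have hzero (c : Fin p) : (S ^ d c) ((T ^ (c : ℕ)) v) = 0 := by
    rw [← Module.End.mul_apply, hTS, mul_assoc, ← pow_add, hT0 _ (hd c), mul_zero,
      LinearMap.zero_apply]
  have hw0 (c) (j : Fin (d c)) (hj : (j : ℕ) = 0) : S (w ⟨c, j⟩) = 0 := by
    have : d c - 1 - j + 1 = d c := by have := j.2; lia
    simp only [w]
    rw [← Module.End.mul_apply, ← pow_succ', this, hzero]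
  have hws (c) (j j' : Fin (d c)) (hj : (j : ℕ) + 1 = j') : S (w ⟨c, j'⟩) = w ⟨c, j⟩ := by
    have : d c - 1 - j' + 1 = d c - 1 - j := by have := j'.2; lia
    simp only [w]
    rw [← Module.End.mul_apply, ← pow_succ', this]
  let W := Submodule.span ℂ (Set.range w)
  have hWS : W.map S ≤ W := by
    rw [Submodule.map_span_le]
    rintro _ ⟨⟨c, j⟩, rfl⟩
    rcases Nat.eq_zero_or_eq_succ_pred (j : ℕ) with hj | hj
    · rw [hw0 c j hj]; exact W.zero_mem
    · have hlt : (j : ℕ) - 1 < d c := by have := j.2; lia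
      rw [hws c ⟨(j : ℕ) - 1, hlt⟩ j (by simp only; lia)]
      exact Submodule.subset_span ⟨_, rfl⟩
  -- A Nakayama argument: the chains span `V` modulo the image of `S`, since `T ^ i v` generates a
  -- chain for `i < p` and lies in that image for `i ≥ p`. Iterating with `S` nilpotent gives `W =
  -- V`.
  have htop : ⊤ ≤ W ⊔ (⊤ : Submodule ℂ V).map S := by
    refine hspan.trans (Submodule.span_le.mpr ?_)
    rintro _ ⟨i, rfl⟩
    rcases lt_or_ge i p with hi | hi
    · refine Submodule.mem_sup_left ?_
      -- Chains are empty when `a = 0` and `i ≥ r`; their would-be generator is then zero.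
      by_cases h0 : d ⟨i, hi⟩ = 0
      · have := hzero ⟨i, hi⟩
        rw [h0, pow_zero] at this
        have h2 : (T ^ i) v = 0 := this
        simp only [h2]
        exact W.zero_mem
      · refine Submodule.subset_span ⟨⟨⟨i, hi⟩, ⟨d ⟨i, hi⟩ - 1, by lia⟩⟩, ?_⟩
        simp [w]
    · refine Submodule.mem_sup_right ?_
      obtain ⟨u', rfl⟩ := hu
      refine ⟨((u'⁻¹ : (Module.End ℂ V)ˣ) : Module.End ℂ V) ((T ^ (i - p)) v), trivial, ?_⟩
      simp only
      rw [← Module.End.mul_apply, ← Module.End.mul_apply, hS, mul_assoc, mul_assoc,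
        Units.mul_inv_cancel_left, ← pow_add, Nat.add_sub_cancel' hi]
  have htop' (m : ℕ) : ⊤ ≤ W ⊔ (⊤ : Submodule ℂ V).map (S ^ m) := by
    induction m with
    | zero => rw [pow_zero]; exact le_sup_of_le_right (by simp [Module.End.one_eq_id])
    | succ m ih =>
      refine htop.trans (sup_le le_sup_left ((Submodule.map_mono ih).trans ?_))
      rw [Submodule.map_sup, pow_succ', Module.End.mul_eq_comp, Submodule.map_comp]
      exact sup_le_sup_right hWS _
  have hWtop : ⊤ ≤ W := by
    have h := htop' (a * p + r)
    -- For `p = 0` the power `p * _` is no help, but `r ≤ p` forces `V = 0`.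
    rcases Nat.eq_zero_or_pos p with rfl | hp
    · obtain rfl : r = 0 := by lia
      have : Subsingleton V := Module.finrank_zero_iff.mp (by simpa using hdim)
      intro x _
      rw [Subsingleton.elim x 0]
      exact W.zero_mem
    · rwa [hTS, hT0 (p * _) (Nat.le_mul_of_pos_left _ hp), mul_zero, Submodule.map_zero,
        sup_bot_eq] at h
  have hcard : Fintype.card (Σ c, Fin (d c)) = Module.finrank ℂ V := by
    rw [hdim, Fintype.card_sigma]
    simp only [Fintype.card_fin, d]
    rw [sum_ite_fin_lt hr]
    obtain ⟨q, rfl⟩ := Nat.exists_eq_add_of_le hr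
    simp
    ring
  refine ⟨Fin p, inferInstance, d, basisOfTopLeSpanOfCardEqFinrank w hWtop hcard, ⟨?_, ?_⟩, ?_⟩
  · simpa using hw0
  · simpa using hws
  · simp only [d, apply_ite cellProfile]
    rw [sum_ite_fin_lt hr]

/-! ### Functions of a single Jordan cell -/

open Polynomial in
/-- The cyclic `ℂ[X]`-module on which `X` acts as a Jordan cell of size `k` and eigenvalue `μ`. -/
abbrev CyclicCell (μ : ℂ) (k : ℕ) : Type := ℂ[X] ⧸ Ideal.span {(X - C μ) ^ k}

open Polynomial in
/-- Multiplication by `X - μ` on the cyclic cell. -/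
noncomputable def cellShift (μ : ℂ) (k : ℕ) : Module.End ℂ (CyclicCell μ k) :=
  Algebra.lmul ℂ (CyclicCell μ k) (Ideal.Quotient.mk _ (X - C μ))

/-- The Taylor expansion of `f` at `μ`, truncated at degree `k` and evaluated at `T`. -/
noncomputable def taylorEnd {V : Type*} [AddCommGroup V] [Module ℂ V] (f : ℂ → ℂ) (μ : ℂ) (k : ℕ)
    (T : Module.End ℂ V) : Module.End ℂ V :=
  ∑ l ∈ Finset.range k, (iteratedDeriv l f μ / (l.factorial : ℂ)) • T ^ l

theorem cellShift_pow_apply_mk (μ : ℂ) (k l : ℕ) (q : Polynomial ℂ) :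
    (cellShift μ k ^ l) (Ideal.Quotient.mk _ q) =
      Ideal.Quotient.mk _ ((Polynomial.X - Polynomial.C μ) ^ l * q) := by
  rw [cellShift, ← map_pow, ← map_pow]
  exact (map_mul _ _ _).symm

theorem cellShift_pow_eq_zero (μ : ℂ) (k : ℕ) : cellShift μ k ^ k = 0 := by
  refine LinearMap.ext fun x => ?_
  obtain ⟨q, rfl⟩ := Ideal.Quotient.mk_surjective x
  rw [cellShift_pow_apply_mk, LinearMap.zero_apply, Ideal.Quotient.eq_zero_iff_mem]
  exact Ideal.mul_mem_right _ _ (Ideal.mem_span_singleton_self _)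

/-- Taylor expansion of a polynomial at `μ` shows that the class of `1` is a cyclic vector. -/
theorem span_cellShift_pow (μ : ℂ) (k : ℕ) :
    ⊤ ≤ Submodule.span ℂ (Set.range fun i : ℕ =>
      (cellShift μ k ^ i) (1 : CyclicCell μ k)) := by
  intro x _
  obtain ⟨q, rfl⟩ := Ideal.Quotient.mk_surjective x
  rw [← Polynomial.sum_taylor_eq q μ, Polynomial.sum, map_sum]
  refine Submodule.sum_mem _ fun i _ => ?_
  rw [← Polynomial.smul_eq_C_mul, ← Ideal.Quotient.mkₐ_eq_mk ℂ, map_smul]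
  refine Submodule.smul_mem _ _ (Submodule.subset_span ⟨i, ?_⟩)
  simp only
  rw [← map_one (Ideal.Quotient.mk _), cellShift_pow_apply_mk, mul_one, Ideal.Quotient.mkₐ_eq_mk]

theorem finrank_cyclicCell (μ : ℂ) (k : ℕ) : Module.finrank ℂ (CyclicCell μ k) = k := by
  rw [finrank_quotient_span_eq_natDegree]
  simp

instance (μ : ℂ) (k : ℕ) : FiniteDimensional ℂ (CyclicCell μ k) :=
  ((Polynomial.monic_X_sub_C μ).pow k).finite_quotient

/-- The first `p` Taylor coefficients vanish and the next does not, so `T ^ p` factors out and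
leaves a nonzero scalar plus a nilpotent, hence a unit. -/
theorem hasJordanProfile_taylorEnd {f : ℂ → ℂ} {μ : ℂ} (hf : AnalyticAt ℂ f μ) {p : ℕ}
    (hp : analyticOrderAt f μ = p) {a r : ℕ} (hr : r ≤ p) :
    HasJordanProfile (taylorEnd f μ (a * p + r) (cellShift μ (a * p + r)))
      ((p - r) • cellProfile a + r • cellProfile (a + 1)) := by
  set k := a * p + r with hk
  set T := cellShift μ k
  have hTk : T ^ k = 0 := cellShift_pow_eq_zero μ k
  obtain ⟨h0, h1⟩ := (analyticOrderAt_eq_nat_iff_iteratedDeriv_eq_zero hf).mp hp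
  let c : ℕ → ℂ := fun l => iteratedDeriv l f μ / (l.factorial : ℂ)
  have hc0 (l : ℕ) (hl : l < p) : c l = 0 := by simp [c, h0 l hl]
  have hcp : c p ≠ 0 := div_ne_zero h1 (by exact_mod_cast p.factorial_ne_zero)
  -- With `k + 1` terms the constant term `c p` is present even if `k = 0`; terms beyond `T ^ k` in
  -- the product vanish anyway.
  let u : Module.End ℂ (CyclicCell μ k) := ∑ l ∈ Finset.range (k + 1), c (p + l) • T ^ l
  have hTu : Commute T u :=
    Commute.sum_right _ _ _ fun l _ => ((Commute.refl T).pow_right l).smul_right _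
  have hu : IsUnit u := by
    have : u = c p • 1 + T * ∑ l ∈ Finset.range k, c (p + (l + 1)) • T ^ l := by
      simp only [u]
      rw [Finset.sum_range_succ', add_comm, Finset.mul_sum]
      simp [pow_succ']
    rw [this]
    have hcomm : Commute T (∑ l ∈ Finset.range k, c (p + (l + 1)) • T ^ l) :=
      Commute.sum_right _ _ _ fun l _ => ((Commute.refl T).pow_right l).smul_right _
    refine IsNilpotent.isUnit_add_left_of_commute (hcomm.isNilpotent_mul_right ⟨k, hTk⟩) ?_
      ((Commute.one_right _).smul_right _)
    exact ⟨⟨c p • 1, (c p)⁻¹ • 1, by simp [hcp], by simp [hcp]⟩, rfl⟩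
  have hS : taylorEnd f μ k T = T ^ p * u := by
    have hbig : taylorEnd f μ k T = ∑ l ∈ Finset.range (p + (k + 1)), c l • T ^ l := by
      refine Finset.sum_subset (Finset.range_subset_range.mpr (by lia)) fun l _ hl => ?_
      rw [pow_eq_zero_of_le (by simpa using hl) hTk, smul_zero]
    rw [hbig, Finset.sum_range_add, Finset.sum_eq_zero, zero_add, Finset.mul_sum]
    · simp [pow_add]
    · intro l hl
      rw [hc0 l (Finset.mem_range.mp hl), zero_smul]
  rw [hS]
  exact hasJordanProfile_pow_mul hr hTk (span_cellShift_pow μ k) (finrank_cyclicCell μ k) hu hTu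

theorem hasJordanProfile_taylorEnd_of_top {f : ℂ → ℂ} {μ : ℂ} (hf : AnalyticAt ℂ f μ)
    (hp : analyticOrderAt f μ = ⊤) (k : ℕ) :
    HasJordanProfile (taylorEnd f μ k (cellShift μ k)) (k • cellProfile 1) := by
  have h0 : taylorEnd f μ k (cellShift μ k) = 0 := by
    refine Finset.sum_eq_zero fun l _ => ?_
    have := (natCast_le_analyticOrderAt_iff_iteratedDeriv_eq_zero (n := l + 1) hf).mp
      (by rw [hp]; exact le_top) l (Nat.lt_succ_self l)
    rw [this, zero_div, zero_smul]
  -- Zero is written as `T ^ k`, with `p = r = k` and `a = 0`, giving `k` chains of length one.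
  have := hasJordanProfile_pow_mul (T := cellShift μ k) (u := 1) (p := k) (a := 0) (r := k) le_rfl
    (by simpa using cellShift_pow_eq_zero μ k) (span_cellShift_pow μ k)
    (by simpa using finrank_cyclicCell μ k) isUnit_one (Commute.one_right _)
  rw [h0]
  simpa [cellShift_pow_eq_zero] using this

/-! ### Decomposition into Jordan cells -/

/-- `e` identifies `X` with a direct sum of Jordan cells with eigenvalues `μ i` and sizes `k i`. -/
def IsJordanDecomposition {V ι : Type*} [AddCommGroup V] [Module ℂ V] (X : Module.End ℂ V)
    {μ : ι → ℂ} {k : ι → ℕ} (e : V ≃ₗ[ℂ] ∀ i, CyclicCell (μ i) (k i)) : Prop :=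
  ∀ v i, e (X v) i = cellShift (μ i) (k i) (e v i) + μ i • e v i

theorem exists_isJordanDecomposition {V : Type} [AddCommGroup V] [Module ℂ V]
    [FiniteDimensional ℂ V] (X : Module.End ℂ V) :
    ∃ (ι : Type) (_ : Fintype ι) (μ : ι → ℂ) (k : ι → ℕ)
      (e : V ≃ₗ[ℂ] ∀ i, CyclicCell (μ i) (k i)), IsJordanDecomposition X e := by
  classical
  have htors : Module.IsTorsion (Polynomial ℂ) (Module.AEval' X) := by
    intro x
    refine ⟨⟨minpoly ℂ X, mem_nonZeroDivisors_of_ne_zero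
      (minpoly.ne_zero (Algebra.IsIntegral.isIntegral X))⟩, ?_⟩
    obtain ⟨v, rfl⟩ := (Module.AEval'.of X).surjective x
    change minpoly ℂ X • Module.AEval.of ℂ V X v = 0
    rw [← Module.AEval.of_aeval_smul, minpoly.aeval, zero_smul, map_zero]
  obtain ⟨ι, _, p, hp, k, ⟨E⟩⟩ := Module.equiv_directSum_of_isTorsion htors
  have hroot (i : ι) : ∃ μ : ℂ, Associated (p i) (Polynomial.X - Polynomial.C μ) := by
    obtain ⟨μ, hμ⟩ := IsAlgClosed.exists_root (p i)
      (by rw [IsAlgClosed.degree_eq_one_of_irreducible ℂ (hp i)]; exact one_ne_zero)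
    exact ⟨μ, ((Polynomial.irreducible_X_sub_C μ).associated_of_dvd (hp i)
      (Polynomial.dvd_iff_isRoot.mpr hμ)).symm⟩
  choose μ hμ using hroot
  have hspan (i : ι) : Submodule.span (Polynomial ℂ) {p i ^ k i} =
      Ideal.span {(Polynomial.X - Polynomial.C (μ i)) ^ k i} :=
    Ideal.span_singleton_eq_span_singleton.mpr ((hμ i).pow_pow)
  let E' : Module.AEval' X ≃ₗ[Polynomial ℂ] ∀ i, CyclicCell (μ i) (k i) :=
    E.trans ((DirectSum.linearEquivFunOnFintype _ _ _).trans
      (LinearEquiv.piCongrRight fun i => Submodule.quotEquivOfEq _ _ (hspan i)))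
  refine ⟨ι, inferInstance, μ, k, (Module.AEval'.of X).trans (E'.restrictScalars ℂ), fun v i => ?_⟩
  change E' (Module.AEval'.of X (X v)) i = _ + μ i • E' (Module.AEval'.of X v) i
  rw [← Module.AEval'.X_smul_of, map_smul, Pi.smul_apply]
  change _ = cellShift (μ i) (k i) (E' (Module.AEval'.of X v) i) + _
  obtain ⟨q, hq⟩ := Ideal.Quotient.mk_surjective (E' (Module.AEval'.of X v) i)
  have hsmul : μ i • (Ideal.Quotient.mk (Ideal.span {(Polynomial.X - Polynomial.C (μ i)) ^ k i})) q =
      Ideal.Quotient.mk _ (Polynomial.C (μ i) * q) := by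
    rw [← Polynomial.smul_eq_C_mul]; rfl
  rw [← hq, ← pow_one (cellShift _ _), cellShift_pow_apply_mk, hsmul, ← map_add, pow_one, sub_mul,
    sub_add_cancel]
  rfl

/-- `S` acts as the Taylor expansion of `f` in `X` on the characteristic subspaces of `X`. -/
def IsFunctionOf {V : Type*} [AddCommGroup V] [Module ℂ V] (f : ℂ → ℂ)
    (X S : Module.End ℂ V) : Prop :=
  ∀ (μ : ℂ) (k : ℕ) (v : V), ((X - μ • 1) ^ k) v = 0 → S v = taylorEnd f μ k (X - μ • 1) v

theorem IsJordanDecomposition.symm_single {V ι : Type*} [AddCommGroup V] [Module ℂ V]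
    [DecidableEq ι] {X : Module.End ℂ V} {μ : ι → ℂ} {k : ι → ℕ}
    {e : V ≃ₗ[ℂ] ∀ i, CyclicCell (μ i) (k i)} (he : IsJordanDecomposition X e) (i : ι)
    (q : CyclicCell (μ i) (k i)) (l : ℕ) :
    ((X - μ i • 1) ^ l) (e.symm (Pi.single i q)) =
      e.symm (Pi.single i ((cellShift (μ i) (k i) ^ l) q)) := by
  induction l with
  | zero => rfl
  | succ l ih =>
    rw [pow_succ', Module.End.mul_apply, ih, pow_succ', Module.End.mul_apply, LinearEquiv.eq_symm_apply]
    ext j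
    simp only [LinearMap.sub_apply, LinearMap.smul_apply, Module.End.one_apply, map_sub, map_smul,
      Pi.sub_apply, Pi.smul_apply, LinearEquiv.apply_symm_apply]
    rw [he, LinearEquiv.apply_symm_apply]
    by_cases hj : j = i
    · subst hj; simp
    · simp [hj]

/-- The `i`-th summand is killed by `(X - μ i) ^ k i`, so `IsFunctionOf` determines `S` on it, and
the summands span. -/
theorem IsJordanDecomposition.apply_functionOf {V ι : Type*} [AddCommGroup V] [Module ℂ V]
    [Fintype ι] {X S : Module.End ℂ V} {μ : ι → ℂ} {k : ι → ℕ}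
    {e : V ≃ₗ[ℂ] ∀ i, CyclicCell (μ i) (k i)} (he : IsJordanDecomposition X e) {f : ℂ → ℂ}
    (hS : IsFunctionOf f X S) (v : V) :
    e (S v) = (LinearMap.pi fun i =>
      taylorEnd f (μ i) (k i) (cellShift (μ i) (k i)) ∘ₗ LinearMap.proj i) (e v) := by
  classical
  have key : e.toLinearMap ∘ₗ S ∘ₗ e.symm.toLinearMap = LinearMap.pi fun i =>
      taylorEnd f (μ i) (k i) (cellShift (μ i) (k i)) ∘ₗ LinearMap.proj i := by
    refine LinearMap.pi_ext fun i q => ?_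
    have h := hS (μ i) (k i) (e.symm (Pi.single i q)) (by
      rw [he.symm_single, cellShift_pow_eq_zero, LinearMap.zero_apply, Pi.single_zero, map_zero])
    simp only [LinearMap.comp_apply, LinearEquiv.coe_coe]
    rw [h]
    simp only [taylorEnd, LinearMap.sum_apply, LinearMap.smul_apply, he.symm_single, map_sum,
      map_smul, LinearEquiv.apply_symm_apply]
    ext j
    by_cases hj : j = i
    · subst hj; simp
    · simp [hj]
  simpa using LinearMap.congr_fun key (e v)

/-! ### The matrix function as a Taylor expansion -/

theorem taylorEnd_apply_of_le {V : Type*} [AddCommGroup V] [Module ℂ V] (f : ℂ → ℂ) (μ : ℂ)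
    {k l : ℕ} (hkl : k ≤ l) {T : Module.End ℂ V} {v : V} (hv : (T ^ k) v = 0) :
    taylorEnd f μ l T v = taylorEnd f μ k T v := by
  simp only [taylorEnd, LinearMap.sum_apply, LinearMap.smul_apply]
  refine (Finset.sum_subset (Finset.range_subset_range.mpr hkl) fun j _ hj => ?_).symm
  rw [Module.End.pow_map_zero_of_le (by simpa using hj) hv, smul_zero]

theorem taylorEnd_apply_eq {V : Type*} [AddCommGroup V] [Module ℂ V] (f : ℂ → ℂ) (μ : ℂ)
    {k l : ℕ} {T : Module.End ℂ V} {v : V} (hv : (T ^ k) v = 0) (hv' : (T ^ l) v = 0) :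
    taylorEnd f μ l T v = taylorEnd f μ k T v := by
  rcases le_total k l with h | h
  · exact taylorEnd_apply_of_le f μ h hv
  · exact (taylorEnd_apply_of_le f μ h hv').symm

theorem toLin'_spectralProjection {n : ℕ} (X : Matrix (Fin n) (Fin n) ℂ) (μ : ℂ) :
    Matrix.toLin' (spectralProjection X μ) =
      Submodule.projection _ _ (isCompl_maxGenEigenspace (Matrix.toLin' X) μ) := by
  rw [spectralProjection, Matrix.toLin'_toMatrix']

theorem toLin'_matrixFunction {n : ℕ} (f : ℂ → ℂ) (X : Matrix (Fin n) (Fin n) ℂ)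
    (v : Fin n → ℂ) :
    Matrix.toLin' (matrixFunction f X) v = ∑ μ ∈ X.charpoly.roots.toFinset,
      taylorEnd f μ n (Matrix.toLin' X - μ • 1)
        (Submodule.projection _ _ (isCompl_maxGenEigenspace (Matrix.toLin' X) μ) v) := by
  have hX (μ : ℂ) : Matrix.toLin' (X - Matrix.scalar (Fin n) μ) = Matrix.toLin' X - μ • 1 := by
    rw [map_sub, Matrix.scalar_apply, ← Matrix.smul_one_eq_diagonal, map_smul, Matrix.toLin'_one]
    rfl
  have hpow (A : Matrix (Fin n) (Fin n) ℂ) (k : ℕ) :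
      Matrix.toLin' (A ^ k) = Matrix.toLin' A ^ k := Matrix.toLin'_pow A k
  rw [matrixFunction, map_sum, LinearMap.sum_apply]
  refine Finset.sum_congr rfl fun μ _ => ?_
  rw [Matrix.toLin'_mul, LinearMap.comp_apply, toLin'_spectralProjection, map_sum]
  simp only [map_smul, hpow, hX, taylorEnd]

/-- On a generalized eigenvector for `μ` only the projection for `μ` survives. Truncating at `n`
instead of `k` changes nothing, because both powers of `X - μ` kill the vector. -/
theorem isFunctionOf_matrixFunction {n : ℕ} (f : ℂ → ℂ) (X : Matrix (Fin n) (Fin n) ℂ) :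
    IsFunctionOf f (Matrix.toLin' X) (Matrix.toLin' (matrixFunction f X)) := by
  intro μ k v hv
  rcases eq_or_ne v 0 with rfl | hv0
  · simp
  have hmem : v ∈ Module.End.maxGenEigenspace (Matrix.toLin' X) μ :=
    (Module.End.mem_maxGenEigenspace _ _ _).mpr ⟨k, hv⟩
  have hroot : μ ∈ X.charpoly.roots.toFinset := by
    have hev : Module.End.HasEigenvalue (Matrix.toLin' X) μ := by
      refine Module.End.hasEigenvalue_of_hasGenEigenvalue (k := k) fun h => hv0 ?_
      rw [← Submodule.mem_bot ℂ, ← h]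
      exact Module.End.mem_genEigenspace_nat.mpr hv
    rw [Multiset.mem_toFinset, Polynomial.mem_roots X.charpoly_monic.ne_zero]
    have := Module.End.hasEigenvalue_iff_isRoot_charpoly _ μ |>.mp hev
    rwa [Matrix.charpoly_toLin'] at this
  have hn : ((Matrix.toLin' X - μ • 1) ^ n) v = 0 := by
    rw [Module.End.maxGenEigenspace_eq_genEigenspace_finrank] at hmem
    simpa using Module.End.mem_genEigenspace_nat.mp hmem
  rw [toLin'_matrixFunction, Finset.sum_eq_single_of_mem μ hroot]
  · rw [Submodule.projection_apply_of_mem_left _ hmem]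
    exact taylorEnd_apply_eq f μ hv hn
  · intro ν _ hν
    rw [(Submodule.projection_apply_eq_zero_iff _).mpr, map_zero]
    exact Submodule.mem_iSup_of_mem μ (Submodule.mem_iSup_of_mem hν.symm hmem)

/-! ### Generators and eigenvalues -/

/-- Sums over cells, some possibly of size zero, are handled in the monoid; only `0` can then be
missing from the semigroup. -/
theorem eq_zero_or_mem_closure_of_mem {M : Type*} [AddCommMonoid M] {s : Set M} {m : M}
    (hm : m ∈ AddSubmonoid.closure s) : m = 0 ∨ m ∈ AddSubsemigroup.closure s := by
  induction hm using AddSubmonoid.closure_induction with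
  | mem x hx => exact Or.inr (AddSubsemigroup.subset_closure hx)
  | zero => exact Or.inl rfl
  | add x y _ _ hx hy =>
    rcases hx with rfl | hx
    · rwa [zero_add]
    · rcases hy with rfl | hy
      · exact Or.inr (by rwa [add_zero])
      · exact Or.inr (add_mem hx hy)

theorem closure_le_addSubmonoid_closure {M : Type*} [AddCommMonoid M] {s : Set M} {m : M}
    (hm : m ∈ AddSubsemigroup.closure s) : m ∈ AddSubmonoid.closure s := by
  induction hm using AddSubsemigroup.closure_induction with
  | mem x hx => exact AddSubmonoid.subset_closure hx
  | add x y _ _ hx hy => exact add_mem hx hy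

theorem HasJordanProfile.finrank_eq_zero {V : Type*} [AddCommGroup V] [Module ℂ V]
    {S : Module.End ℂ V} (h : HasJordanProfile S 0) : Module.finrank ℂ V = 0 := by
  obtain ⟨s, d, b, -, hm⟩ := h.exists_pnat
  rw [Module.finrank_eq_card_basis b, Fintype.card_eq_zero_iff]
  refine ⟨fun ⟨i, _⟩ => ?_⟩
  have := sum_cellProfile_apply d (d i)
  rw [← hm, Finsupp.zero_apply] at this
  exact Finset.card_ne_zero_of_mem (a := i) (by simp) this.symm

/-- The function `f` of a Jordan cell has a profile generated by the profile generators. -/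
theorem exists_profile_taylorEnd {U : Set ℂ} {f : ℂ → ℂ} (hf : AnalyticOnNhd ℂ f U) {μ : ℂ}
    (k : ℕ) (hμ : k ≠ 0 → μ ∈ U ∧ f μ = 0) :
    ∃ m ∈ AddSubmonoid.closure (profileGenerators U f),
      HasJordanProfile (taylorEnd f μ k (cellShift μ k)) m := by
  rcases eq_or_ne k 0 with rfl | hk
  · refine ⟨0, zero_mem _, ?_⟩
    have : HasJordanProfile (taylorEnd f μ 0 (cellShift μ 0)) ((0 - 0) • cellProfile 0 + 0 • cellProfile 1) := by
      have h := hasJordanProfile_pow_mul (T := cellShift μ 0) (u := 1) (p := 0) (a := 0) (r := 0)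
        le_rfl (by simpa using cellShift_pow_eq_zero μ 0) (span_cellShift_pow μ 0)
        (by simpa using finrank_cyclicCell μ 0) isUnit_one (Commute.one_right _)
      convert h using 1
      have := cellShift_pow_eq_zero μ 0
      simp only [taylorEnd, Finset.range_zero, Finset.sum_empty, mul_one, this]
    simpa using this
  obtain ⟨hU, h0⟩ := hμ hk
  have hfμ := hf μ hU
  rcases eq_or_ne (analyticOrderAt f μ) ⊤ with htop | htop
  · refine ⟨k • cellProfile 1, nsmul_mem (AddSubmonoid.subset_closure ?_) k,
      hasJordanProfile_taylorEnd_of_top hfμ htop k⟩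
    exact Or.inr ⟨⟨μ, hU, h0, htop⟩, rfl⟩
  · obtain ⟨p, hp⟩ := ENat.ne_top_iff_exists.mp htop
    have hp0 : 0 < p := by
      refine Nat.pos_of_ne_zero ?_
      rintro rfl
      exact (hfμ.analyticOrderAt_eq_zero.mp hp.symm) h0
    -- Euclidean division `k = (k / p) p + k % p` supplies `a` and `r`.
    have h := hasJordanProfile_taylorEnd hfμ hp.symm (a := k / p) (Nat.mod_lt k hp0).le
    rw [Nat.div_add_mod' k p] at h
    exact ⟨_, AddSubmonoid.subset_closure (Or.inl ⟨μ, hU, h0, p, hp.symm, k / p, k % p,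
      (Nat.mod_lt k hp0).le, rfl⟩), h⟩

/-- Every profile generator is the profile of the function `f` of a Jordan cell. -/
theorem exists_cell_of_mem_profileGenerators {U : Set ℂ} {f : ℂ → ℂ} (hf : AnalyticOnNhd ℂ f U)
    {m : ℕ+ →₀ ℕ} (hm : m ∈ profileGenerators U f) :
    ∃ μ ∈ U, ∃ k : ℕ, HasJordanProfile (taylorEnd f μ k (cellShift μ k)) m := by
  rcases hm with ⟨μ, hU, -, p, hp, a, r, hr, rfl⟩ | ⟨⟨μ, hU, -, hp⟩, rfl⟩
  · exact ⟨μ, hU, _, hasJordanProfile_taylorEnd (hf μ hU) hp hr⟩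
  · exact ⟨μ, hU, 1, by simpa using hasJordanProfile_taylorEnd_of_top (hf μ hU) hp 1⟩

theorem IsJordanDecomposition.hasEigenvector {V ι : Type*} [AddCommGroup V] [Module ℂ V]
    [DecidableEq ι] {X : Module.End ℂ V} {μ : ι → ℂ} {k : ι → ℕ}
    {e : V ≃ₗ[ℂ] ∀ i, CyclicCell (μ i) (k i)} (he : IsJordanDecomposition X e) {i : ι}
    (hi : k i ≠ 0) : ∃ v, v ≠ 0 ∧ X v = μ i • v := by
  have : Nontrivial (CyclicCell (μ i) (k i)) :=
    Module.nontrivial_of_finrank_pos (R := ℂ) (by rw [finrank_cyclicCell]; lia)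
  obtain ⟨q, hq, hq0⟩ : ∃ q, cellShift (μ i) (k i) q = 0 ∧ q ≠ 0 := by
    by_contra! h
    have hinj : Function.Injective (cellShift (μ i) (k i)) :=
      (injective_iff_map_eq_zero _).mpr h
    obtain ⟨x, hx⟩ := exists_ne (0 : CyclicCell (μ i) (k i))
    refine hx (hinj.iterate (k i) ?_)
    rw [← Module.End.coe_pow, cellShift_pow_eq_zero, LinearMap.zero_apply, LinearMap.zero_apply]
  refine ⟨e.symm (Pi.single i q), by simpa using hq0, ?_⟩
  have := he.symm_single i q 1
  rw [pow_one, pow_one, hq, Pi.single_zero, map_zero] at this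
  exact sub_eq_zero.mp this

theorem IsJordanDecomposition.exists_eq_of_eigenvector {V ι : Type*} [AddCommGroup V] [Module ℂ V]
    {X : Module.End ℂ V} {μ : ι → ℂ} {k : ι → ℕ}
    {e : V ≃ₗ[ℂ] ∀ i, CyclicCell (μ i) (k i)} (he : IsJordanDecomposition X e) {ν : ℂ} {v : V}
    (hv : v ≠ 0) (hXv : X v = ν • v) : ∃ i, μ i = ν := by
  obtain ⟨i, hi⟩ : ∃ i, e v i ≠ 0 := by
    by_contra! h
    exact hv (e.map_eq_zero_iff.mp (funext h))
  refine ⟨i, ?_⟩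
  have h1 : cellShift (μ i) (k i) (e v i) = (ν - μ i) • e v i := by
    have := he v i
    rw [hXv, map_smul, Pi.smul_apply] at this
    rw [sub_smul, this, add_sub_cancel_right]
  have h2 (l : ℕ) : (cellShift (μ i) (k i) ^ l) (e v i) = (ν - μ i) ^ l • e v i := by
    induction l with
    | zero => simp
    | succ l ih => rw [pow_succ', Module.End.mul_apply, ih, map_smul, h1, smul_smul, pow_succ]
  have h3 := h2 (k i)
  rw [cellShift_pow_eq_zero, LinearMap.zero_apply, eq_comm, smul_eq_zero] at h3
  exact (sub_eq_zero.mp (eq_zero_of_pow_eq_zero (h3.resolve_right hi))).symm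

/-! ### The equivalence -/

theorem mainTheorem2 (U : Set ℂ) (hU : IsOpen U) (f : ℂ → ℂ) (hf : AnalyticOnNhd ℂ f U)
    (n : ℕ) (hn : 0 < n) (N : Matrix (Fin n) (Fin n) ℂ) (hN : IsNilpotent N) :
    (∃ X : Matrix (Fin n) (Fin n) ℂ, spectrum ℂ X ⊆ U ∧ matrixFunction f X = N) ↔
      ∃ m : ℕ+ →₀ ℕ, IsJordanProfile N m ∧
        m ∈ AddSubsemigroup.closure (profileGenerators U f) := by
  classical
  constructor
  · rintro ⟨X, hX, rfl⟩
    obtain ⟨ι, _, μ, k, e, he⟩ := exists_isJordanDecomposition (Matrix.toLin' X)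
    have hfun := isFunctionOf_matrixFunction f X
    have hμ (i : ι) (hi : k i ≠ 0) : μ i ∈ U ∧ f (μ i) = 0 := by
      obtain ⟨v, hv, hXv⟩ := he.hasEigenvector hi
      constructor
      · refine hX ?_
        rw [← Matrix.spectrum_toLin']
        exact (Module.End.hasEigenvalue_of_hasEigenvector
          (Module.End.hasEigenvector_iff.mpr ⟨Module.End.mem_eigenspace_iff.mpr hXv, hv⟩)).mem_spectrum
      -- An eigenvector of `X` is one of `f(X)` with eigenvalue `f (μ i)`, which nilpotency forces
      -- to be zero.
      · have hS : Matrix.toLin' (matrixFunction f X) v = f (μ i) • v := by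
          rw [hfun (μ i) 1 v (by simp [hXv])]
          simp [taylorEnd]
        obtain ⟨r, hr⟩ := hN
        have hpow (l : ℕ) : (Matrix.toLin' (matrixFunction f X) ^ l) v = f (μ i) ^ l • v := by
          induction l with
          | zero => simp
          | succ l ih => rw [pow_succ', Module.End.mul_apply, ih, map_smul, hS, smul_smul, pow_succ]
        have h := hpow r
        rw [← Matrix.toLin'_pow, hr, map_zero, LinearMap.zero_apply, eq_comm, smul_eq_zero] at h
        exact eq_zero_of_pow_eq_zero (h.resolve_right hv)
    choose m hm hprof using fun i => exists_profile_taylorEnd hf (k i) (hμ i)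
    have hS : HasJordanProfile (Matrix.toLin' (matrixFunction f X)) (∑ i, m i) :=
      (HasJordanProfile.pi hprof).conj e.symm fun v => by
        rw [LinearEquiv.symm_apply_eq, he.apply_functionOf hfun, LinearEquiv.apply_symm_apply]
    refine ⟨_, (isJordanProfile_iff _ _).mpr hS, ?_⟩
    -- A zero profile would force `n = 0`.
    refine (eq_zero_or_mem_closure_of_mem (sum_mem fun i _ => hm i)).resolve_left fun h0 => ?_
    rw [h0] at hS
    have := hS.finrank_eq_zero
    simp at this
    lia
  · rintro ⟨m, hNm, hm⟩
    rw [isJordanProfile_iff] at hNm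
    obtain ⟨L, hL, rfl⟩ :=
      AddSubmonoid.exists_list_of_mem_closure (closure_le_addSubmonoid_closure hm)
    choose μ hμ k hk using fun i : Fin L.length =>
      exists_cell_of_mem_profileGenerators hf (hL (L.get i) (L.get_mem i))
    have hprof := HasJordanProfile.pi hk
    have hsum : ∑ i, L.get i = L.sum := by simp [Fin.sum_univ_getElem]
    rw [hsum] at hprof
    obtain ⟨φ, hφ⟩ := hNm.exists_equiv hprof
    -- `φ` conjugates `N` to the function `f` of `Y`, so pulling `Y` back along `φ` gives exactly
    -- `f(X) = N`.
    let Y : Module.End ℂ (∀ i, CyclicCell (μ i) (k i)) :=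
      LinearMap.pi fun i => (cellShift (μ i) (k i) + μ i • 1) ∘ₗ LinearMap.proj i
    let X := LinearMap.toMatrix' (φ.symm.toLinearMap ∘ₗ Y ∘ₗ φ.toLinearMap)
    have hφX : IsJordanDecomposition (Matrix.toLin' X) φ := by
      intro v i
      simp [X, Y]
    refine ⟨X, fun ν hν => ?_, Matrix.toLin'.injective (LinearMap.ext fun v => φ.injective ?_)⟩
    · rw [← Matrix.spectrum_toLin'] at hν
      obtain ⟨v, hv⟩ := (Module.End.HasEigenvalue.of_mem_spectrum hν).exists_hasEigenvector
      obtain ⟨i, rfl⟩ := hφX.exists_eq_of_eigenvector hv.2 hv.apply_eq_smul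
      exact hμ i
    · rw [hφX.apply_functionOf (isFunctionOf_matrixFunction f X), hφ]
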